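/- All graphs are simple (no loops or multiple edges) and locally finite; $d_x$ is the degree of a vertex $x$, and $d(x,y)$ is the combinatorial distance. For $p\in[0,1]$ and a vertex $x$ with at least one neighbour, let $\mu_x^p$ be the probability measure on the vertex set with $\mu_x^p(x)=p$, $\mu_x^p(z)=\frac{1-p}{d_x}$ if $z\sim x$, and $\mu_x^p(z)=0$ otherwise. For an edge $x\sim y$ let $$\kappa_p(x,y)=1-W_1(\mu_x^p,\mu_y^p),$$ where $W_1(\mu_1,\mu_2)=\inf_\pi\sum_{u,v}d(u,v)\,\pi(u,v)$ is the $1$-Wasserstein distance, the infimum being over all nonnegative $\pi$ on $V\times V$ with $\sum_v\pi(u,v)=\mu_1(u)$ for all $u$ and $\sum_u\pi(u,v)=\mu_2(v)$ for all $v$. A graph is called bone idle if $\kappa_p(x,y)=0$ for every edge $x\sim y$ and every $p\in[0,1]$. The girth of a graph is the length of its shortest cycle ($\infty$ if there is none). Corollary. Let $G$ be a connected, locally finite graph with at least two vertices and girth at least $5$, and suppose that $G$ is bone idle. Then $G$ is isomorphic to the (two-way) infinite path, with vertex set $\mathbb{Z}$ and $m\sim n$ if and only if $|m-n|=1$, or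 to the cycle $C_n$ for some $n\ge 6$. In particular, there is no (connected or disconnected) locally finite bone idle graph of girth exactly $5$. -/

import Mathlib

open scoped ENNReal

noncomputable section

namespace OllivierRicci

/-- A transport plan (coupling) `π` between two mass distributions `μ₁`, `μ₂` on a discrete set:
the row sums of `π` are `μ₁` and its column sums are `μ₂`. All values and sums live in `[0, ∞]`,
so no summability convention is involved; if `μ₁` is a probability distribution, then the values
of `π` automatically lie in `[0, 1]`. -/
structure IsTransportPlan {V : Type*} (μ₁ μ₂ : V → ℝ≥0∞) (π : V → V → ℝ≥0∞) : Prop where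
  row_sum : ∀ x, ∑' y, π x y = μ₁ x
  col_sum : ∀ y, ∑' x, π x y = μ₂ y

/-- The 1-Wasserstein distance with respect to the combinatorial distance of the graph `G`
(which is `∞` between different connected components): the infimum of the total transport
cost over all transport plans. -/
def wasserstein {V : Type*} (G : SimpleGraph V) (μ₁ μ₂ : V → ℝ≥0∞) : ℝ≥0∞ :=
  ⨅ (π : V → V → ℝ≥0∞) (_ : IsTransportPlan μ₁ μ₂ π),
    ∑' y, ∑' x, (G.edist x y : ℝ≥0∞) * π x y

open Classical in
/-- The mass distribution `μ_x^p`: mass `p` at `x` and mass `(1 - p) / d_x` at each neighbour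
of `x`. For `p ∈ [0, 1]` it is a probability distribution as soon as `x` has a neighbour. -/
def idleMeasure {V : Type*} (G : SimpleGraph V) [G.LocallyFinite] (p : ℝ) (x : V) :
    V → ℝ≥0∞ := fun z =>
  if z = x then ENNReal.ofReal p
  else if G.Adj x z then ENNReal.ofReal ((1 - p) / (G.degree x : ℝ))
  else 0

/-- The `p`-Ollivier-Ricci curvature `κ_p(x, y) = 1 - W₁(μ_x^p, μ_y^p)` of an edge `x ∼ y`.
(For an edge and `p ∈ [0, 1]` the Wasserstein distance is at most `3`, hence finite.) -/
def kappa {V : Type*} (G : SimpleGraph V) [G.LocallyFinite] (p : ℝ) (x y : V) : ℝ :=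
  1 - (wasserstein G (idleMeasure G p x) (idleMeasure G p y)).toReal

/-- `G` is bone idle if `κ_p(x, y) = 0` for every edge `x ∼ y` and every idleness `p ∈ [0, 1]`. -/
def IsBoneIdle {V : Type*} (G : SimpleGraph V) [G.LocallyFinite] : Prop :=
  ∀ x y, G.Adj x y → ∀ p ∈ Set.Icc (0 : ℝ) 1, kappa G p x y = 0

/-- The (two-way) infinite path: the vertex set is `ℤ`, and `m ∼ n` iff `m` and `n` are
consecutive integers. -/
def infinitePath : SimpleGraph ℤ where
  Adj m n := m + 1 = n ∨ n + 1 = m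
  symm := ⟨fun _ _ h => h.symm⟩
  loopless := ⟨fun _ h => by omega⟩

end OllivierRicci

end

open scoped ENNReal

namespace OllivierRicci

/-! ### Transport estimates across an edge. -/

section Transport

variable {V : Type*} {G : SimpleGraph V}

/-! Girth at least 5 keeps the other neighbours of x at distance at least 2 from the other
neighbours of y when x ∼ y. At idleness 0 this gives W₁ ≥ 2 - 1/d_x - 1/d_y
(`two_le_wasserstein_add`), while bone idleness says W₁ = 1, so 1/d_x + 1/d_y ≥ 1. Explicit plans at
idleness 1/2 rule out leaves (`degree_ne_one`), so all non-isolated vertices have degree 2, and then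
rule out 5-cycles (`two_lt_edist`). These arguments are local, so girth 5 is impossible without
connectedness too. A 2-regular graph carries a walk indexed by ℤ that never turns back
(`exists_isLine`). In a connected graph it visits every vertex, and its period separates the
infinite path from the cycles (`nonempty_iso`). -/

/-- The plan which moves mass `w i` from `f i` to `g i`, for `i ∈ s`, bounds the Wasserstein
distance from above. -/
theorem wasserstein_le_sum [DecidableEq V] {ι : Type*} (s : Finset ι) (f g : ι → V)
    (w : ι → ℝ≥0∞) {μ₁ μ₂ : V → ℝ≥0∞}
    (h₁ : ∀ u, ∑ i ∈ s, (if u = f i then w i else 0) = μ₁ u)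
    (h₂ : ∀ v, ∑ i ∈ s, (if v = g i then w i else 0) = μ₂ v) :
    wasserstein G μ₁ μ₂ ≤ ∑ i ∈ s, (G.edist (f i) (g i) : ℝ≥0∞) * w i := by
  let π : V → V → ℝ≥0∞ := fun u v => ∑ i ∈ s, if u = f i then (if v = g i then w i else 0) else 0
  have swap (F : V → ι → ℝ≥0∞) : ∑' v, ∑ i ∈ s, F v i = ∑ i ∈ s, ∑' v, F v i :=
    Summable.tsum_finsetSum fun _ _ => ENNReal.summable
  have hπ : IsTransportPlan μ₁ μ₂ π := by
    constructor
    · intro u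
      rw [swap, ← h₁ u]
      refine Finset.sum_congr rfl fun i _ => ?_
      split_ifs <;> simp
    · intro v
      rw [swap, ← h₂ v]
      refine Finset.sum_congr rfl fun i _ => ?_
      simp
  refine (iInf₂_le π hπ).trans_eq ?_
  simp only [π, Finset.mul_sum, swap]
  refine Finset.sum_congr rfl fun i _ => ?_
  simp [mul_ite]

theorem IsBoneIdle.wasserstein_eq_one [G.LocallyFinite] (h : IsBoneIdle G) {x y : V}
    (hxy : G.Adj x y) {p : ℝ} (hp : p ∈ Set.Icc (0 : ℝ) 1) :
    wasserstein G (idleMeasure G p x) (idleMeasure G p y) = 1 := by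
  have := h x y hxy p hp
  rw [kappa, sub_eq_zero, eq_comm, ENNReal.toReal_eq_one_iff] at this
  exact this

theorem idleMeasure_self [G.LocallyFinite] (p : ℝ) (x : V) :
    idleMeasure G p x x = ENNReal.ofReal p := by
  simp [idleMeasure]

theorem idleMeasure_of_adj [G.LocallyFinite] (p : ℝ) {x z : V} (h : G.Adj x z) :
    idleMeasure G p x z = ENNReal.ofReal ((1 - p) / (G.degree x : ℝ)) := by
  simp [idleMeasure, h, h.ne']

theorem idleMeasure_of_not_adj [G.LocallyFinite] (p : ℝ) {x z : V} (hne : z ≠ x)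
    (h : ¬ G.Adj x z) : idleMeasure G p x z = 0 := by
  simp [idleMeasure, h, hne]

theorem idleMeasure_zero_of_not_adj [G.LocallyFinite] {x z : V} (h : ¬ G.Adj x z) :
    idleMeasure G 0 x z = 0 := by
  by_cases hz : z = x
  · simp [hz, idleMeasure_self]
  · exact idleMeasure_of_not_adj 0 hz h

theorem tsum_idleMeasure_zero [G.LocallyFinite] {x y : V} (hxy : G.Adj x y) :
    ∑' z, idleMeasure G 0 x z = 1 := by
  rw [tsum_eq_sum (s := G.neighborFinset x)
    (fun z hz => idleMeasure_zero_of_not_adj (by simpa using hz)),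
    Finset.sum_congr rfl fun z hz => idleMeasure_of_adj 0 ((G.mem_neighborFinset x z).1 hz)]
  have hd : 0 < G.degree x := (G.degree_pos_iff_exists_adj x).2 ⟨y, hxy⟩
  have hd' : (0 : ℝ) < G.degree x := by exact_mod_cast hd
  rw [Finset.sum_const, G.card_neighborFinset_eq_degree, nsmul_eq_mul, ← ENNReal.ofReal_natCast,
    ← ENNReal.ofReal_mul hd'.le]
  field_simp
  simp

/-- On an edge in a graph without triangles and squares, the transport of `μ_x^0` to `μ_y^0` costs
at least `2`, up to the mass at `y` in `μ_x^0` and the mass at `x` in `μ_y^0`. -/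
theorem two_le_wasserstein_add [G.LocallyFinite] {x y : V} (hxy : G.Adj x y)
    (h3 : ∀ u, G.Adj x u → ¬ G.Adj y u)
    (h4 : ∀ u v, G.Adj x u → G.Adj y v → u ≠ y → v ≠ x → ¬ G.Adj u v) :
    2 ≤ wasserstein G (idleMeasure G 0 x) (idleMeasure G 0 y) +
      (ENNReal.ofReal (1 / (G.degree x : ℝ)) + ENNReal.ofReal (1 / (G.degree y : ℝ))) := by
  classical
  rw [← tsub_le_iff_right]
  refine le_iInf₂ fun π hπ => ?_
  rw [tsub_le_iff_right]
  -- On the support of `π` the distance is at least 1, and at least 2 unless `u = y` or `v = x`; the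
  -- indicator terms make up the deficit in those cases.
  have hcost (u v : V) : 2 * π u v ≤ (G.edist u v : ℝ≥0∞) * π u v +
      ((if u = y then π u v else 0) + (if v = x then π u v else 0)) := by
    by_cases hu : G.Adj x u
    swap
    · have := hπ.row_sum u
      rw [idleMeasure_zero_of_not_adj hu, ENNReal.tsum_eq_zero] at this
      simp [this v]
    by_cases hv : G.Adj y v
    swap
    · have := hπ.col_sum v
      rw [idleMeasure_zero_of_not_adj hv, ENNReal.tsum_eq_zero] at this
      simp [this u]
    have hne : u ≠ v := by
      rintro rfl
      exact h3 u hu hv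
    have h1 : (1 : ℝ≥0∞) ≤ (G.edist u v : ℝ≥0∞) := by
      have : (1 : ℕ∞) ≤ G.edist u v := Order.one_le_iff_pos.2 (SimpleGraph.edist_pos_of_ne hne)
      exact_mod_cast ENat.toENNReal_le.2 this
    have h1' : π u v ≤ (G.edist u v : ℝ≥0∞) * π u v := le_mul_of_one_le_left' h1
    by_cases huy : u = y
    · rw [if_pos huy, two_mul]
      gcongr
      exact le_self_add
    by_cases hvx : v = x
    · rw [if_pos hvx, two_mul]
      gcongr
      exact le_add_self
    have h2 : (2 : ℝ≥0∞) ≤ (G.edist u v : ℝ≥0∞) := by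
      have : (2 : ℕ∞) ≤ G.edist u v := by
        have hlt : 1 < G.edist u v := by
          rw [← not_le, SimpleGraph.edist_le_one_iff_adj_or_eq]
          exact fun h => h.elim (h4 u v hu hv huy hvx) hne
        simpa [one_add_one_eq_two] using Order.add_one_le_of_lt hlt
      exact_mod_cast ENat.toENNReal_le.2 this
    calc 2 * π u v ≤ (G.edist u v : ℝ≥0∞) * π u v := by gcongr
      _ ≤ _ := le_self_add
  have htot : ∑' v, ∑' u, 2 * π u v = 2 := by
    simp only [ENNReal.tsum_mul_left, hπ.col_sum, tsum_idleMeasure_zero hxy.symm, mul_one]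
  have hy : ∑' v, ∑' u, (if u = y then π u v else 0) = ENNReal.ofReal (1 / (G.degree x : ℝ)) := by
    simp only [tsum_ite_eq, hπ.row_sum, idleMeasure_of_adj 0 hxy, sub_zero]
  have hx : ∑' v, ∑' u, (if v = x then π u v else 0) = ENNReal.ofReal (1 / (G.degree y : ℝ)) := by
    rw [ENNReal.tsum_comm]
    simp only [tsum_ite_eq, hπ.col_sum, idleMeasure_of_adj 0 hxy.symm, sub_zero]
  calc (2 : ℝ≥0∞) = ∑' v, ∑' u, 2 * π u v := htot.symm
    _ ≤ ∑' v, ∑' u, ((G.edist u v : ℝ≥0∞) * π u v +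
        ((if u = y then π u v else 0) + (if v = x then π u v else 0))) :=
      ENNReal.tsum_le_tsum fun v => ENNReal.tsum_le_tsum fun u => hcost u v
    _ = _ := by simp only [ENNReal.tsum_add, hx, hy]

/-- With cost 1 the lower bound reads 1/d_x + 1/d_y ≥ 1, while both terms are at most 1/2. -/
theorem IsBoneIdle.degree_eq_two_of_two_le [G.LocallyFinite] (h : IsBoneIdle G) {x y : V}
    (hxy : G.Adj x y)
    (h3 : ∀ u, G.Adj x u → ¬ G.Adj y u)
    (h4 : ∀ u v, G.Adj x u → G.Adj y v → u ≠ y → v ≠ x → ¬ G.Adj u v)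
    (hx : 2 ≤ G.degree x) (hy : 2 ≤ G.degree y) : G.degree x = 2 ∧ G.degree y = 2 := by
  have key := two_le_wasserstein_add hxy h3 h4
  rw [h.wasserstein_eq_one hxy (by simp), ← ENNReal.ofReal_add (by positivity) (by positivity),
    ← ENNReal.ofReal_one, ← ENNReal.ofReal_add (by positivity) (by positivity),
    ← ENNReal.ofReal_ofNat, ENNReal.ofReal_le_ofReal_iff (by positivity)] at key
  have hx' : (2 : ℝ) ≤ G.degree x := by exact_mod_cast hx
  have hy' : (2 : ℝ) ≤ G.degree y := by exact_mod_cast hy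
  have hx2 : 1 / (G.degree x : ℝ) ≤ 1 / 2 := one_div_le_one_div_of_le two_pos hx'
  have hy2 : 1 / (G.degree y : ℝ) ≤ 1 / 2 := one_div_le_one_div_of_le two_pos hy'
  have hx3 : (G.degree x : ℝ) ≤ 2 := le_of_one_div_le_one_div two_pos (by linarith)
  have hy3 : (G.degree y : ℝ) ≤ 2 := le_of_one_div_le_one_div two_pos (by linarith)
  norm_cast at hx3 hy3
  omega

/-- A bone idle graph has no leaves. -/
theorem IsBoneIdle.degree_ne_one [G.LocallyFinite] (h : IsBoneIdle G) (x : V) :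
    G.degree x ≠ 1 := by
  classical
  intro hx
  obtain ⟨y, hxy, hxu⟩ := (SimpleGraph.degree_eq_one_iff_existsUnique_adj).1 hx
  -- At idleness 1/2 both measures give `y` mass 1/2, which stays put. The mass at `x` is spread
  -- over the neighbours of `y`, each at distance at most 2; the share left at `x` is free, so the
  -- cost is below 1.
  have hW := h.wasserstein_eq_one hxy (p := 1 / 2) (by constructor <;> norm_num)
  have hb : 0 < G.degree y := (G.degree_pos_iff_exists_adj y).2 ⟨x, hxy.symm⟩
  have hb' : (0 : ℝ) < G.degree y := by exact_mod_cast hb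
  let s := G.neighborFinset y
  let m : ℝ≥0∞ := ENNReal.ofReal ((1 - 1 / 2) / (G.degree y : ℝ))
  have hys : y ∉ s := by simp [s]
  have hxs : x ∈ s := by simpa [s] using hxy.symm
  have hs : ∀ z ∈ s, idleMeasure G (1 / 2) y z = m := fun z hz =>
    idleMeasure_of_adj _ ((G.mem_neighborFinset y z).1 hz)
  have hm : ∑ z ∈ s, m = ENNReal.ofReal (1 / 2) := by
    rw [Finset.sum_const, G.card_neighborFinset_eq_degree, nsmul_eq_mul,
      ← ENNReal.ofReal_natCast, ← ENNReal.ofReal_mul hb'.le]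
    congr 1
    field_simp
    norm_num
  have hne : ∀ z ∈ s, z ≠ y := fun z hz hzy => hys (hzy ▸ hz)
  have hle := wasserstein_le_sum (G := G) (insert y s) (fun z => if z = y then y else x) id
    (idleMeasure G (1 / 2) y) (μ₁ := idleMeasure G (1 / 2) x) (μ₂ := idleMeasure G (1 / 2) y)
    (by
      intro u
      rw [Finset.sum_insert hys,
        Finset.sum_congr (g := fun z => if u = x then m else 0) rfl
          (fun z hz => by rw [if_neg (hne z hz), hs z hz])]
      by_cases hux : u = x
      · subst hux
        simp [hxy.ne, idleMeasure_self, hm]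
      by_cases huy : u = y
      · subst huy
        have h1 : ((1 : ℝ) - 1 / 2) / (1 : ℕ) = 1 / 2 := by norm_num
        simp only [hux, idleMeasure_self, idleMeasure_of_adj _ hxy, hx, h1, if_true, if_false,
          Finset.sum_const_zero, add_zero]
      · simp [hux, huy, idleMeasure_of_not_adj _ hux fun h => huy (hxu u h)])
    (by
      intro v
      simp only [id, Finset.sum_ite_eq]
      rw [ite_eq_left_iff]
      intro hv
      rw [Finset.mem_insert, not_or, G.mem_neighborFinset] at hv
      rw [idleMeasure_of_not_adj _ hv.1 hv.2])
  have hmpos : 0 < m := ENNReal.ofReal_pos.2 (by positivity)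
  have hcost : ∑ i ∈ insert y s, (G.edist (if i = y then y else x) (id i) : ℝ≥0∞) *
      idleMeasure G (1 / 2) y i ≤ ∑ z ∈ s.erase x, 2 * m := by
    rw [Finset.sum_insert hys]
    simp only [if_true, id, SimpleGraph.edist_self, ENat.toENNReal_zero, zero_mul, zero_add]
    rw [← Finset.add_sum_erase s _ hxs]
    simp only [hxy.ne, if_false, SimpleGraph.edist_self, ENat.toENNReal_zero, zero_mul, zero_add]
    refine Finset.sum_le_sum fun z hz => ?_
    have hz' := Finset.mem_of_mem_erase hz
    rw [hs z hz', if_neg (hne z hz')]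
    gcongr
    have hyz : G.Adj y z := (G.mem_neighborFinset y z).1 hz'
    have : G.edist x z ≤ 2 := by
      simpa using SimpleGraph.edist_le (.cons hxy (.cons hyz .nil))
    exact_mod_cast ENat.toENNReal_le.2 this
  have hlt : ∑ z ∈ s.erase x, 2 * m < 1 := by
    have h1 : ∑ z ∈ s, 2 * m = 1 := by
      rw [← Finset.mul_sum, hm, ← ENNReal.ofReal_ofNat, ← ENNReal.ofReal_mul (by norm_num)]
      norm_num
    rw [← Finset.add_sum_erase s _ hxs] at h1
    rw [← h1]
    rw [add_comm]
    refine ENNReal.lt_add_right ?_ (mul_ne_zero two_ne_zero hmpos.ne')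
    exact ne_top_of_le_ne_top (by simp) (h1 ▸ le_add_self)
  exact absurd hW (hle.trans_lt (hcost.trans_lt hlt)).ne

/-- The middle edge of a path `x' x y y'` with inner vertices of degree two whose ends have
distance at most two has positive curvature for some idleness. -/
theorem IsBoneIdle.two_lt_edist [G.LocallyFinite] (h : IsBoneIdle G) {x' x y y' : V}
    (hx' : G.Adj x x') (hxy : G.Adj x y) (hy' : G.Adj y y') (hx'y : x' ≠ y) (hy'x : y' ≠ x)
    (hx : G.degree x = 2) (hy : G.degree y = 2) : 2 < G.edist x' y' := by
  classical
  by_contra! hd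
  have hW := h.wasserstein_eq_one hxy (p := 1 / 2) (by constructor <;> norm_num)
  have hNx : G.neighborFinset x = {x', y} := by
    refine (Finset.eq_of_subset_of_card_le ?_ ?_).symm
    · simp [Finset.insert_subset_iff, hx', hxy]
    · rw [G.card_neighborFinset_eq_degree, hx, Finset.card_pair hx'y]
  have hNy : G.neighborFinset y = {y', x} := by
    refine (Finset.eq_of_subset_of_card_le ?_ ?_).symm
    · simp [Finset.insert_subset_iff, hy', hxy.symm]
    · rw [G.card_neighborFinset_eq_degree, hy, Finset.card_pair hy'x]
  have hax (z : V) : G.Adj x z ↔ z = x' ∨ z = y := by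
    rw [← G.mem_neighborFinset, hNx]; simp
  have hay (z : V) : G.Adj y z ↔ z = y' ∨ z = x := by
    rw [← G.mem_neighborFinset, hNy]; simp
  have hq : ENNReal.ofReal (1 / 2) = ENNReal.ofReal (1 / 4) + ENNReal.ofReal (1 / 4) := by
    rw [← ENNReal.ofReal_add] <;> norm_num
  -- Four packets of mass 1/4: two stay, one crosses the edge, one goes from `x'` to `y'`. The cost
  -- is at most (1 + 2)/4.
  have hle := wasserstein_le_sum (G := G) (Finset.univ : Finset (Fin 4)) ![x, x, y, x'] ![x, y, y, y']
    (fun _ => ENNReal.ofReal (1 / 4))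
    (μ₁ := idleMeasure G (1 / 2) x) (μ₂ := idleMeasure G (1 / 2) y)
    (by
      intro u
      have h4 : ((1 : ℝ) - 1 / 2) / (2 : ℕ) = 1 / 4 := by norm_num
      simp only [idleMeasure, hx, hax, h4, hq, Fin.sum_univ_four]
      by_cases h1 : u = x
      · subst h1; simp [hxy.ne, hx'.ne]
      by_cases h2 : u = y
      · subst h2; simp [h1, hx'y.symm]
      by_cases h3 : u = x'
      · subst h3; simp [h1, h2]
      simp [h1, h2, h3])
    (by
      intro u
      have h4 : ((1 : ℝ) - 1 / 2) / (2 : ℕ) = 1 / 4 := by norm_num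
      simp only [idleMeasure, hy, hay, h4, hq, Fin.sum_univ_four]
      by_cases h1 : u = y
      · subst h1; simp [hxy.ne', hy'.ne]
      by_cases h2 : u = x
      · subst h2; simp [h1, hy'x.symm]
      by_cases h3 : u = y'
      · subst h3; simp [h1, h2]
      simp [h1, h2, h3])
  have hd' : (G.edist x' y' : ℝ≥0∞) ≤ 2 := by exact_mod_cast ENat.toENNReal_le.2 hd
  have hcost : ∑ i : Fin 4, (G.edist (![x, x, y, x'] i) (![x, y, y, y'] i) : ℝ≥0∞) *
      ENNReal.ofReal (1 / 4) ≤ ENNReal.ofReal (3 / 4) := by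
    simp only [Fin.sum_univ_four, Matrix.cons_val, SimpleGraph.edist_self,
      SimpleGraph.edist_eq_one_iff_adj.2 hxy, ENat.toENNReal_zero, ENat.toENNReal_one, zero_mul,
      zero_add, add_zero, one_mul]
    calc _ ≤ ENNReal.ofReal (1 / 4) + 2 * ENNReal.ofReal (1 / 4) := by gcongr
      _ = _ := by
        rw [← ENNReal.ofReal_ofNat, ← ENNReal.ofReal_mul (by norm_num),
          ← ENNReal.ofReal_add (by norm_num) (by norm_num)]
        norm_num
  refine absurd hW (hle.trans_lt (hcost.trans_lt ?_)).ne
  rw [← ENNReal.ofReal_one]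
  exact (ENNReal.ofReal_lt_ofReal_iff one_pos).2 (by norm_num)

end Transport

/-! ### Consequences of the girth bound. -/

section Girth

variable {V : Type*} {G : SimpleGraph V}

theorem not_adj_of_five_le_egirth (hg : 5 ≤ G.egirth) {x y u : V} (hxy : G.Adj x y)
    (hxu : G.Adj x u) : ¬ G.Adj y u := by
  intro hyu
  have hc : (SimpleGraph.Walk.cons hxy (.cons hyu (.cons hxu.symm .nil))).IsCycle := by
    simp [SimpleGraph.Walk.cons_isCycle_iff, hxy.ne, hxy.ne', hxu.ne, hxu.ne', hyu.ne]
  have := hg.trans (SimpleGraph.egirth_le_length hc)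
  simp at this
  norm_cast at this

theorem not_adj_of_five_le_egirth' (hg : 5 ≤ G.egirth) {x y u v : V} (hxy : G.Adj x y)
    (hxu : G.Adj x u) (hyv : G.Adj y v) (huy : u ≠ y) (hvx : v ≠ x) : ¬ G.Adj u v := by
  intro huv
  have hc : (SimpleGraph.Walk.cons hxy
      (.cons hyv (.cons huv.symm (.cons hxu.symm .nil)))).IsCycle := by
    simp [SimpleGraph.Walk.cons_isCycle_iff, hxy.ne, hxy.ne', hxu.ne, hxu.ne', hyv.ne,
      huv.ne', huy.symm, hvx, hvx.symm]
  have := hg.trans (SimpleGraph.egirth_le_length hc)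
  simp at this
  norm_cast at this

theorem IsBoneIdle.degree_eq_two [G.LocallyFinite] (h : IsBoneIdle G) (hg : 5 ≤ G.egirth) {x y : V}
    (hxy : G.Adj x y) : G.degree x = 2 := by
  have hx : 0 < G.degree x := (G.degree_pos_iff_exists_adj x).2 ⟨y, hxy⟩
  have hy : 0 < G.degree y := (G.degree_pos_iff_exists_adj y).2 ⟨x, hxy.symm⟩
  have hx1 := h.degree_ne_one x
  have hy1 := h.degree_ne_one y
  exact (h.degree_eq_two_of_two_le hxy (fun u hu => not_adj_of_five_le_egirth hg hxy hu)
    (fun u v hu hv huy hvx => not_adj_of_five_le_egirth' hg hxy hu hv huy hvx)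
    (by omega) (by omega)).1

theorem IsBoneIdle.egirth_ne_five [G.LocallyFinite] (h : IsBoneIdle G) : G.egirth ≠ 5 := by
  intro hg
  have hcyc : ¬ G.IsAcyclic := by
    rw [← SimpleGraph.egirth_eq_top, hg]
    exact ENat.natCast_ne_top 5
  obtain ⟨a, w, hw, hl⟩ := SimpleGraph.exists_egirth_eq_length.2 hcyc
  rw [hg] at hl
  have hl : w.length = 5 := by exact_mod_cast hl.symm
  match w, hw, hl with
  | .cons (v := b) hab (.cons (v := c) hbc (.cons (v := d) hcd (.cons (v := e) hde
      (.cons hea .nil)))), hw, _ =>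
    have hn := hw.support_nodup
    simp at hn
    have hd : G.edist a d ≤ 2 := by
      simpa using SimpleGraph.edist_le (.cons hea.symm (.cons hde.symm .nil))
    -- The path `a b c d` has its ends joined through `e`.
    exact absurd (h.two_lt_edist hab.symm hbc hcd (by tauto) (by tauto)
      (h.degree_eq_two hg.ge hbc) (h.degree_eq_two hg.ge hcd)) hd.not_gt

end Girth

/-! ### Classification of connected 2-regular graphs. -/

section TwoRegular

variable {V : Type*} {G : SimpleGraph V}

/-- The bi-infinite sequence `f` runs through a graph without turning back, and its terms have no
neighbours outside the sequence. -/
structure IsLine (G : SimpleGraph V) (f : ℤ → V) : Prop where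
  adj_iff : ∀ i v, G.Adj (f i) v ↔ v = f (i - 1) ∨ v = f (i + 1)
  ne : ∀ i, f (i - 1) ≠ f (i + 1)

namespace IsLine

variable {f g : ℤ → V}

theorem shift (hf : IsLine G f) (m : ℤ) : IsLine G fun i => f (m + i) where
  adj_iff i v := by simpa only [add_sub_assoc, add_assoc] using hf.adj_iff (m + i) v
  ne i := by simpa only [add_sub_assoc, add_assoc] using hf.ne (m + i)

theorem neg (hf : IsLine G f) : IsLine G fun i => f (-i) where
  adj_iff i v := by
    rw [hf.adj_iff, or_comm, show -i + 1 = -(i - 1) by ring, show -i - 1 = -(i + 1) by ring]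
  ne i := by
    have := (hf.ne (-i)).symm
    rwa [show -i + 1 = -(i - 1) by ring, show -i - 1 = -(i + 1) by ring] at this

theorem ne_succ (hf : IsLine G f) (i : ℤ) : f i ≠ f (i + 1) :=
  ((hf.adj_iff i _).2 (Or.inr rfl)).ne

theorem eq_add_two (hf : IsLine G f) (hg : IsLine G g) {i : ℤ} (h0 : f (i - 1) = g (i - 1))
    (h1 : f i = g i) : f (i + 1) = g (i + 1) := by
  have h := (hf.adj_iff i _).2 (Or.inr rfl)
  rw [h1, hg.adj_iff, ← h0] at h
  exact h.resolve_left (hf.ne i).symm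

theorem eq_nat (hf : IsLine G f) (hg : IsLine G g) (h0 : f 0 = g 0) (h1 : f 1 = g 1) (n : ℕ) :
    f n = g n ∧ f (n + 1) = g (n + 1) := by
  induction n with
  | zero => exact ⟨by simpa using h0, by simpa using h1⟩
  | succ n ih =>
    push_cast
    exact ⟨ih.2, hf.eq_add_two hg (by simpa using ih.1) ih.2⟩

/-- Since a line never turns back, two consecutive values force the rest in both directions. -/
theorem ext (hf : IsLine G f) (hg : IsLine G g) (h0 : f 0 = g 0) (h1 : f 1 = g 1) : f = g := by
  have hn : f (-1) = g (-1) := by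
    have := hf.neg.eq_add_two hg.neg (i := 0) (by simpa using h1) (by simpa using h0)
    simpa using this
  funext i
  obtain ⟨n, rfl | rfl⟩ := i.eq_nat_or_neg
  · exact (hf.eq_nat hg h0 h1 n).1
  · exact (hf.neg.eq_nat hg.neg (by simpa using h0) hn n).1

theorem periodic_of_eq (hf : IsLine G f) {m k : ℤ} (h : f m = f k) (i : ℤ) :
    f (m + i) = f (k + i) := by
  have h1 := (hf.adj_iff m _).2 (Or.inr rfl)
  rw [h, hf.adj_iff] at h1
  rcases h1 with h1 | h1
  -- Here the line would be its own reflection, `f (m + i) = f (k - i)`. At the midpoint of `m` and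
  -- `k` it would turn back (even gap) or repeat a vertex (odd gap).
  · exfalso
    have key := (hf.shift m).ext (hf.shift k).neg (by simpa using h)
      (by simpa [sub_eq_add_neg] using h1)
    obtain ⟨t, ht | ht⟩ := Int.even_or_odd' (k - m)
    · have := congrFun key (t + 1)
      refine hf.ne (m + t) ?_
      convert this.symm using 2 <;> omega
    · have := congrFun key t
      refine hf.ne_succ (m + t) ?_
      convert this using 2
      omega
  · exact congrFun ((hf.shift m).ext (hf.shift k) (by simpa using h) h1) i

/-- The periods form a subgroup of ℤ, hence a cyclic one; `n = 0` is the injective case. -/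
theorem exists_period (hf : IsLine G f) : ∃ n : ℕ, ∀ i j, f i = f j ↔ (n : ℤ) ∣ i - j := by
  let H : AddSubgroup ℤ :=
    { carrier := {k | ∀ i, f (i + k) = f i}
      zero_mem' := fun i => by simp
      add_mem' := fun {a b} ha hb i => by rw [← add_assoc, hb, ha]
      neg_mem' := fun {a} ha i => by simpa using (ha (i + -a)).symm }
  obtain ⟨a, ha⟩ := Int.subgroup_cyclic H
  refine ⟨a.natAbs, fun i j => ?_⟩
  rw [Int.natAbs_dvd, ← Int.mem_zmultiples_iff, AddSubgroup.zmultiples_eq_closure, ← ha]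
  refine ⟨fun h l => ?_, fun h => ?_⟩
  · have := hf.periodic_of_eq h (l - j)
    rwa [show i + (l - j) = l + (i - j) by ring, add_sub_cancel] at this
  · simpa using h j

theorem surjective (hf : IsLine G f) (hG : G.Connected) : Function.Surjective f := by
  have key (u v : V) (w : G.Walk u v) : u ∈ Set.range f → v ∈ Set.range f := by
    induction w with
    | nil => exact id
    | cons h _ ih =>
      rintro ⟨i, rfl⟩
      exact ih (((hf.adj_iff i _).1 h).elim (fun e => ⟨_, e.symm⟩) fun e => ⟨_, e.symm⟩)
  intro v
  obtain ⟨w⟩ := hG.preconnected (f 0) v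
  exact key _ _ w ⟨0, rfl⟩

theorem nonempty_iso (hf : IsLine G f) (hG : G.Connected) :
    Nonempty (G ≃g infinitePath) ∨ ∃ n : ℕ, 3 ≤ n ∧ Nonempty (G ≃g SimpleGraph.cycleGraph n) := by
  obtain ⟨n, hn⟩ := hf.exists_period
  have hsurj := hf.surjective hG
  rcases Nat.eq_zero_or_pos n with rfl | hpos
  · left
    have hinj : Function.Injective f := fun i j h => by
      simpa [sub_eq_zero] using (hn i j).1 h
    refine ⟨SimpleGraph.Iso.symm ⟨Equiv.ofBijective f ⟨hinj, hsurj⟩, ?_⟩⟩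
    intro i j
    change G.Adj (f i) (f j) ↔ i + 1 = j ∨ j + 1 = i
    rw [hf.adj_iff, hinj.eq_iff, hinj.eq_iff]
    omega
  · right
    have h1 : n ≠ 1 := by
      rintro rfl
      exact hf.ne_succ 0 ((hn _ _).2 (by simp))
    have h2 : n ≠ 2 := by
      rintro rfl
      exact hf.ne 0 ((hn _ _).2 (by norm_num))
    have h3 : 3 ≤ n := by omega
    refine ⟨n, h3, ?_⟩
    have hbij : Function.Bijective fun i : Fin n => f (i : ℕ) := by
      constructor
      · intro i j h
        have h := (hn _ _).1 h
        rw [← Int.modEq_iff_dvd, Int.natCast_modEq_iff] at h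
        exact Fin.ext (h.eq_of_lt_of_lt j.2 i.2).symm
      · intro v
        obtain ⟨i, rfl⟩ := hsurj v
        have hn0 : (n : ℤ) ≠ 0 := by omega
        have hlt := Int.emod_lt_of_pos i (show (0 : ℤ) < n by omega)
        have hnn := Int.emod_nonneg i hn0
        refine ⟨⟨(i % n).toNat, by omega⟩, (hn _ _).2 ?_⟩
        rw [Int.toNat_of_nonneg hnn]
        exact ⟨-(i / n), by linarith [Int.emod_add_mul_ediv i n]⟩
    refine ⟨SimpleGraph.Iso.symm ⟨Equiv.ofBijective _ hbij, ?_⟩⟩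
    have hsub (i j : Fin n) : (i - j).val = 1 ↔ (n : ℤ) ∣ (j : ℕ) - ((i : ℕ) - 1) := by
      have hj := j.2
      rw [Fin.val_sub, ← Nat.mod_eq_of_lt (show 1 < n by omega)]
      change _ ≡ 1 [MOD n] ↔ _
      -- Subtraction in `Fin n` is computed from `n - j + i`; adding `n` cancels this offset.
      rw [Nat.modEq_iff_dvd, ← dvd_add_self_right]
      push_cast [hj.le]
      ring_nf
    intro i j
    simp only [Equiv.ofBijective_apply, hf.adj_iff, hn, SimpleGraph.cycleGraph_adj', hsub]
    refine or_congr Iff.rfl ?_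
    rw [← dvd_neg]
    ring_nf

end IsLine

theorem exists_isLine [G.LocallyFinite] (h2 : ∀ v, G.degree v = 2) [Nonempty V] :
    ∃ f : ℤ → V, IsLine G f := by
  classical
  have hex (v u : V) : ∃ w, G.Adj v u → w ≠ u ∧ ∀ z, G.Adj v z ↔ z = u ∨ z = w := by
    by_cases hvu : G.Adj v u
    swap
    · exact ⟨v, fun h => absurd h hvu⟩
    obtain ⟨a, b, hab, hN⟩ := Finset.card_eq_two.1 (h2 v)
    have hz (z : V) : G.Adj v z ↔ z = a ∨ z = b := by
      rw [← G.mem_neighborFinset, hN]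
      simp
    rcases (hz u).1 hvu with rfl | rfl
    · exact ⟨b, fun _ => ⟨hab.symm, hz⟩⟩
    · exact ⟨a, fun _ => ⟨hab, fun z => (hz z).trans or_comm⟩⟩
  choose o ho using hex
  have ho_ne {v u : V} (h : G.Adj v u) : o v u ≠ u := (ho v u h).1
  have ho_iff {v u : V} (h : G.Adj v u) (z : V) : G.Adj v z ↔ z = u ∨ z = o v u := (ho v u h).2 z
  have ho_adj {v u : V} (h : G.Adj v u) : G.Adj v (o v u) := (ho_iff h _).2 (Or.inr rfl)
  have ho_o {v u : V} (h : G.Adj v u) : o v (o v u) = u :=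
    (((ho_iff h _).1 (ho_adj (ho_adj h))).resolve_right (ho_ne (ho_adj h)))
  -- Advancing a directed edge, (u, v) ↦ (v, `o v u`), is invertible, so its integer powers give a
  -- two-sided walk even when the graph is a finite cycle.
  let φ : Equiv.Perm {p : V × V // G.Adj p.1 p.2} :=
    { toFun := fun p => ⟨(p.1.2, o p.1.2 p.1.1), ho_adj p.2.symm⟩
      invFun := fun p => ⟨(o p.1.1 p.1.2, p.1.1), (ho_adj p.2).symm⟩
      left_inv := fun p => Subtype.ext (Prod.ext (ho_o p.2.symm) rfl)
      right_inv := fun p => Subtype.ext (Prod.ext rfl (ho_o p.2)) }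
  obtain ⟨x⟩ := ‹Nonempty V›
  obtain ⟨y, hxy⟩ := (G.degree_pos_iff_exists_adj x).1 (by rw [h2 x]; exact two_pos)
  let d (i : ℤ) := (φ ^ i) ⟨(x, y), hxy⟩
  have hsucc (i : ℤ) : (d (i + 1)).1.1 = (d i).1.2 := by
    have : d (i + 1) = φ (d i) := by
      simp only [d, add_comm i 1, zpow_one_add, Equiv.Perm.mul_apply]
    rw [this]
    rfl
  have hpred (i : ℤ) : (d (i - 1)).1.1 = o (d i).1.1 (d i).1.2 := by
    have : d (i - 1) = φ.symm (d i) := by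
      rw [Equiv.eq_symm_apply]
      change φ ((φ ^ (i - 1)) _) = (φ ^ i) _
      rw [← Equiv.Perm.mul_apply, ← zpow_one_add, add_sub_cancel]
    rw [this]
    rfl
  refine ⟨fun i => (d i).1.1, fun i v => ?_, fun i => ?_⟩
  · rw [hsucc, hpred, or_comm]
    exact ho_iff (d i).2 v
  · rw [hsucc, hpred]
    exact ho_ne (d i).2

end TwoRegular

/-! ### Girth of cycles and conclusion. -/

section Cycle

theorem egirth_cycleGraph_le {n : ℕ} (hn : 3 ≤ n) : (SimpleGraph.cycleGraph n).egirth ≤ n := by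
  obtain ⟨m, rfl⟩ := Nat.exists_eq_add_of_le' hn
  have := SimpleGraph.egirth_le_length (SimpleGraph.cycleGraph.isCycle_cycle (n := m))
  rwa [SimpleGraph.cycleGraph.length_cycle] at this

end Cycle

end OllivierRicci

theorem mainTheorem5 {V : Type*} (G : SimpleGraph V) [G.LocallyFinite] :
    (G.Connected → Nontrivial V → 5 ≤ G.egirth → OllivierRicci.IsBoneIdle G →
      Nonempty (G ≃g OllivierRicci.infinitePath) ∨
        ∃ n : ℕ, 6 ≤ n ∧ Nonempty (G ≃g SimpleGraph.cycleGraph n)) ∧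
    ¬ (OllivierRicci.IsBoneIdle G ∧ G.egirth = 5) := by
  refine ⟨fun hG hV hg h => ?_, fun h => h.1.egirth_ne_five h.2⟩
  have h2 (v : V) : G.degree v = 2 := by
    obtain ⟨u, hu⟩ := hG.preconnected.exists_adj_of_nontrivial v
    exact h.degree_eq_two hg hu
  have := hG.nonempty
  obtain ⟨f, hf⟩ := OllivierRicci.exists_isLine h2
  refine (hf.nonempty_iso hG).imp_right ?_
  rintro ⟨n, hn, ⟨e⟩⟩
  refine ⟨n, ?_, ⟨e⟩⟩
  have hle : G.egirth ≤ n := e.egirth_eq.trans_le (OllivierRicci.egirth_cycleGraph_le hn)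
  have h5 : 5 ≤ n := by exact_mod_cast hg.trans hle
  have hne : n ≠ 5 := by
    rintro rfl
    exact h.egirth_ne_five (le_antisymm hle hg)
  omega
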